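/- **Definitions.** Strings are over the integer alphabet $\{0,\dots,\sigma-1\}$; $\overline{S}$ is the string $S$ read backwards. A factorization $T=F_1\cdots F_z$ is the *reversed LZ factorization with self-references* of $T$ if, for every $x$, the factor $F_x$ is a single letter that does not occur in $F_1\cdots F_{x-1}$, or else (if the first letter of $F_x$ occurs in $F_1\cdots F_{x-1}$) $F_x$ is the longest prefix of $F_x\cdots F_z$ such that each non-empty prefix $F$ of $F_x$ (including $F_x$ itself) has its inverted copy $\overline{F}$ as a substring of $F_1\cdots F_{x-1}F$. The model is the deterministic word RAM with unit-cost operations on words of $w=\Omega(\log (n+\sigma))$ bits, where $n$ is the length of the input; a letter fits in one word. The suffix tree of $S$ is the compacted trie of all suffixes of $S$; its nodes are the suffixes of $S$ (including the empty one, the root) and the substrings of $S$ that are followed in $S$ by two distinct letters. An *online suffix tree algorithm* maintains the suffix tree of a string $S$ that grows in front from the empty string, in $O(|S|+1)$ words of space, with permanent node addresses that are bounded by $O(|S|+1)$. Its update operation (SuffixUpdate) is given a letter $c$, turns the suffix tree of $S$ into that of $cS$, and reports the new leaf, the insertion point (the longest prefix of $cS$ that occurs in $S$) and the closest old node at or below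 the insertion point. Moreover, one can query the child of a node by the first letter of the edge, and the string depth of a node. Let $t_{\mathrm{SU}}(n,\sigma)$ be an upper bound for the worst-case time of every single update or query while $|S|\le n$, valid for all pairs $(n,\sigma)$ in some range $R$. **Theorem.** For every online suffix tree algorithm with time bound $t_{\mathrm{SU}}$ on a range $R$ there is a word-RAM algorithm that computes the reversed LZ factorization with self-references online in linear space and $O(t_{\mathrm{SU}})$ worst-case time per letter: for all $(n,\sigma)\in R$ it reads any string $T[1..n]$ over $\{0,\dots,\sigma-1\}$ letter by letter from left to right; after each $j\le n$ letters its memory holds the number and the starting positions of the factors of the reversed LZ factorization with self-references of $T[1..j]$; it spends $O(t_{\mathrm{SU}}(n,\sigma))$ time on each single letter; and it uses $O(j)$ words of space while processing the first $j$ letters. The constants do not depend on $n$, $\sigma$, $w$ and $T$. -/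

import Mathlib

namespace RevLZ

/-! ## The word RAM

Programs of a word RAM with word size `w`, written as structured code over finitely many registers
and finitely many arrays of words.  Every basic instruction, operation and test costs one unit of
time. -/

/-- A machine state: the contents of the registers, and the contents of the cells of the arrays
(`mem a i` is cell `i` of array `a`).  A program is a finite piece of code, hence it refers to
finitely many registers and finitely many arrays only. -/
structure State where
  reg : ℕ → ℕ
  mem : ℕ → ℕ → ℕ

/-- The initial state, in which everything is zero. -/
def State.zero : State := ⟨fun _ => 0, fun _ _ => 0⟩

/-- Write `v` into register `r`. -/
def State.setReg (st : State) (r v : ℕ) : State :=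
  { st with reg := Function.update st.reg r v }

/-- Write `v` into cell `i` of array `a`. -/
def State.setMem (st : State) (a i v : ℕ) : State :=
  { st with mem := Function.update st.mem a (Function.update (st.mem a) i v) }

/-- The arithmetic, bitwise and comparison operations on words. -/
inductive BinOp where
  | add | sub | mul | div | mod | land | lor | lxor | shl | shr | eq | lt

/-- The operations on words of `w` bits; results are reduced modulo `2 ^ w`, and comparisons
return `1` (true) or `0` (false). -/
def BinOp.eval (w : ℕ) : BinOp → ℕ → ℕ → ℕ
  | .add, x, y => (x + y) % 2 ^ w
  | .sub, x, y => (x + (2 ^ w - y)) % 2 ^ w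
  | .mul, x, y => (x * y) % 2 ^ w
  | .div, x, y => (x / y) % 2 ^ w
  | .mod, x, y => (x % y) % 2 ^ w
  | .land, x, y => (x &&& y) % 2 ^ w
  | .lor, x, y => (x ||| y) % 2 ^ w
  | .lxor, x, y => (x ^^^ y) % 2 ^ w
  | .shl, x, y => (x <<< y) % 2 ^ w
  | .shr, x, y => (x >>> y) % 2 ^ w
  | .eq, x, y => (if x = y then 1 else 0) % 2 ^ w
  | .lt, x, y => (if x < y then 1 else 0) % 2 ^ w

/-- Expressions over registers; `wordSize` is the word size of the machine. -/
inductive Expr where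
  | const (v : ℕ)
  | wordSize
  | reg (r : ℕ)
  | op (o : BinOp) (e₁ e₂ : Expr)

/-- The value of an expression on a machine with word size `w`. -/
def Expr.eval (w : ℕ) (st : State) : Expr → ℕ
  | .const v => v % 2 ^ w
  | .wordSize => w
  | .reg r => st.reg r
  | .op o e₁ e₂ => o.eval w (e₁.eval w st) (e₂.eval w st)

/-- The time needed to evaluate an expression. -/
def Expr.cost : Expr → ℕ
  | .const _ => 1
  | .wordSize => 1
  | .reg _ => 1
  | .op _ e₁ e₂ => e₁.cost + e₂.cost + 1

/-- Programs. -/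
inductive Cmd where
  | skip
  | assign (r : ℕ) (e : Expr)
  /-- `load r a e`: read cell `e` of array `a` into register `r`. -/
  | load (r a : ℕ) (e : Expr)
  /-- `store a e₁ e₂`: write `e₂` into cell `e₁` of array `a`. -/
  | store (a : ℕ) (e₁ e₂ : Expr)
  | seq (c₁ c₂ : Cmd)
  | ite (e : Expr) (c₁ c₂ : Cmd)
  | loop (e : Expr) (c : Cmd)

/-- `Exec w m c st k st'`: on a machine with word size `w`, the program `c` started in `st` halts
in `st'` after `k` time steps, and accesses only the first `m` cells of each array.
An access to any other cell blocks, and so does an infinite loop. -/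
inductive Exec (w m : ℕ) : Cmd → State → ℕ → State → Prop where
  | skip (st : State) : Exec w m .skip st 1 st
  | assign (r : ℕ) (e : Expr) (st : State) :
      Exec w m (.assign r e) st (e.cost + 1) (st.setReg r (e.eval w st))
  | load (r a : ℕ) (e : Expr) (st : State) (h : e.eval w st < m) :
      Exec w m (.load r a e) st (e.cost + 1) (st.setReg r (st.mem a (e.eval w st)))
  | store (a : ℕ) (e₁ e₂ : Expr) (st : State) (h : e₁.eval w st < m) :
      Exec w m (.store a e₁ e₂) st (e₁.cost + e₂.cost + 1)
        (st.setMem a (e₁.eval w st) (e₂.eval w st))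
  | seq (c₁ c₂ : Cmd) (st st₁ st₂ : State) (k₁ k₂ : ℕ) (h₁ : Exec w m c₁ st k₁ st₁)
      (h₂ : Exec w m c₂ st₁ k₂ st₂) : Exec w m (.seq c₁ c₂) st (k₁ + k₂) st₂
  | ite_true (e : Expr) (c₁ c₂ : Cmd) (st st' : State) (k : ℕ) (he : e.eval w st ≠ 0)
      (h : Exec w m c₁ st k st') : Exec w m (.ite e c₁ c₂) st (e.cost + k + 1) st'
  | ite_false (e : Expr) (c₁ c₂ : Cmd) (st st' : State) (k : ℕ) (he : e.eval w st = 0)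
      (h : Exec w m c₂ st k st') : Exec w m (.ite e c₁ c₂) st (e.cost + k + 1) st'
  | loop_stop (e : Expr) (c : Cmd) (st : State) (he : e.eval w st = 0) :
      Exec w m (.loop e c) st (e.cost + 1) st
  | loop_step (e : Expr) (c : Cmd) (st st₁ st₂ : State) (k₁ k₂ : ℕ) (he : e.eval w st ≠ 0)
      (h₁ : Exec w m c st k₁ st₁) (h₂ : Exec w m (.loop e c) st₁ k₂ st₂) :
      Exec w m (.loop e c) st (e.cost + k₁ + k₂ + 1) st₂

/-! ## Suffix trees

Letters are natural numbers and strings are lists of letters.  `u <:+: S`, `u <+: S` and `u <:+ S`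
say that `u` is a substring, a prefix, a suffix of `S`. -/

/-- The nodes of the suffix tree of `S`, identified with their labels: the suffixes of `S`
(including the empty one, the root), and the substrings of `S` that are followed by two distinct
letters. -/
def IsNode (S u : List ℕ) : Prop :=
  u <:+ S ∨ ∃ a b : ℕ, a ≠ b ∧ (u ++ [a]) <:+: S ∧ (u ++ [b]) <:+: S

/-- `b` is the closest node of the suffix tree of `S` at or below the locus of the string `g`. -/
def IsLocusNode (S g b : List ℕ) : Prop :=
  IsNode S b ∧ g <+: b ∧ ∀ b', IsNode S b' → g <+: b' → b.length ≤ b'.length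

/-- `g` is the insertion point for the new suffix `c :: S`: its longest prefix that occurs
in `S`. -/
def IsInsertionPoint (S : List ℕ) (c : ℕ) (g : List ℕ) : Prop :=
  g <+: (c :: S) ∧ g <:+: S ∧ ∀ g', g' <+: (c :: S) → g' <:+: S → g'.length ≤ g.length

/-- The word-RAM routines of an online suffix tree. -/
structure SuffixTreeProgram where
  /-- extends the indexed string by one letter in front -/
  update : Cmd
  /-- descends from a node along the edge that begins with a given letter -/
  child : Cmd
  /-- returns the string depth of a node -/
  depth : Cmd

/-- On a machine with word size `w`, the routines of `D` maintain the suffix tree of a string over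
the alphabet `{0, …, σ - 1}` that grows letter by letter in front from the empty string up to
length `n`; every single call takes at most `τ` steps, and at most `s * (ℓ + 1)` cells of each array
are used while the string has length at most `ℓ`.
`Rep S addr st` is the representation invariant: the state `st` represents the suffix tree of `S`,
the node with label `u` being accessed through the word `addr u`. -/
structure SuffixTreeProgram.Maintains (D : SuffixTreeProgram) (w n σ τ s : ℕ)
    (Rep : List ℕ → (List ℕ → ℕ) → State → Prop) : Prop where
  /-- The initial state represents the suffix tree of the empty string. -/
  start : ∃ addr, Rep [] addr State.zero
  /-- Distinct nodes have distinct addresses, these are bounded linearly in the length of the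
  string, and the root has address `0`. -/
  address : ∀ S addr st, Rep S addr st →
    addr [] = 0 ∧ (∀ u, IsNode S u → addr u < s * (S.length + 1)) ∧
      ∀ u v, IsNode S u → IsNode S v → addr u = addr v → u = v
  /-- Given a letter `c` in register `0`, `update` turns the suffix tree of `S` into that of
  `c :: S`, where the old nodes keep their addresses.  It returns in registers `0`, `1` and `2` the
  new leaf, the insertion point (at which the new leaf has been attached), and the node of the old
  tree at the insertion point or, if an edge has been split there, at the lower end of that
  edge. -/
  update : ∀ S addr st c, Rep S addr st → c < σ → S.length < n →
    ∃ k ≤ τ, ∃ st' addr', Exec w (s * (S.length + 2)) D.update (st.setReg 0 c) k st' ∧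
      Rep (c :: S) addr' st' ∧ (∀ u, IsNode S u → addr' u = addr u) ∧
      ∃ g b, IsInsertionPoint S c g ∧ IsLocusNode S g b ∧
        st'.reg 0 = addr' (c :: S) ∧ st'.reg 1 = addr' g ∧ st'.reg 2 = addr' b
  /-- Given a node `u` in register `0` and a letter `a` in register `1`, `child` returns `1` in
  register `0` and the lower end of the edge below `u` that begins with `a` in register `1`,
  if there is such an edge, and `0` in register `0` otherwise. -/
  child : ∀ S addr st u a, Rep S addr st → IsNode S u → a < σ →
    ∃ k ≤ τ, ∃ st', Exec w (s * (S.length + 1)) D.child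
        ((st.setReg 0 (addr u)).setReg 1 a) k st' ∧
      Rep S addr st' ∧
      ((∃ b, IsLocusNode S (u ++ [a]) b ∧ st'.reg 0 = 1 ∧ st'.reg 1 = addr b) ∨
        (¬ (u ++ [a]) <:+: S ∧ st'.reg 0 = 0))
  /-- Given a node in register `0`, `depth` returns the length of its label in register `0`. -/
  depth : ∀ S addr st u, Rep S addr st → IsNode S u →
    ∃ k ≤ τ, ∃ st', Exec w (s * (S.length + 1)) D.depth (st.setReg 0 (addr u)) k st' ∧
      Rep S addr st' ∧ st'.reg 0 = u.length

/-- `D` maintains suffix trees online in worst-case time `t n σ` per operation and in linear space,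
for all lengths `n` and alphabet sizes `σ` in the range `R`, on every machine whose word size is at
least a certain constant times `log (n + σ + 2)`. -/
def SuffixTreeProgram.Solves (D : SuffixTreeProgram) (R : ℕ → ℕ → Prop) (t : ℕ → ℕ → ℕ) : Prop :=
  ∃ s κ : ℕ, ∀ n σ w : ℕ, R n σ → (n + σ + 2) ^ κ ≤ 2 ^ w →
    ∃ Rep, D.Maintains w n σ (t n σ) s Rep

/-! ## The reversed LZ factorization with self-references -/

/-- Each non-empty prefix `G` of `F` (including `F` itself) has an inverted copy that is a substring
of `Q ++ G`, where `Q` is the part of the text before `F`. -/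
def HasInvertedCopies (Q F : List ℕ) : Prop :=
  ∀ G, G ≠ [] → G <+: F → G.reverse <:+: (Q ++ G)

/-- `F` is the factor that follows the text `Q`, where `Z` is the remaining text (beginning
with `F`): the first occurrence of a letter, or else the longest prefix of `Z` with
inverted copies. -/
def IsFactor (Q Z F : List ℕ) : Prop :=
  (∃ c, c ∉ Q ∧ F = [c]) ∨
    ((∃ c ∈ Q, [c] <+: F) ∧ HasInvertedCopies Q F ∧
      ∀ G, G <+: Z → HasInvertedCopies Q G → G.length ≤ F.length)

/-- `Fs` is the reversed LZ factorization with self-references of `T`. -/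
def IsOverlapRevLZ (T : List ℕ) (Fs : List (List ℕ)) : Prop :=
  Fs.flatten = T ∧
    ∀ (x : ℕ) (hx : x < Fs.length), IsFactor (Fs.take x).flatten (Fs.drop x).flatten Fs[x]

/-- The state `st` holds the factorization of `T`: the number of factors is in register `z`, and the
(0-based) starting positions of the factors are in the first cells of array `a`. -/
def HoldsFactorization (z a : ℕ) (T : List ℕ) (st : State) : Prop :=
  ∃ Fs, IsOverlapRevLZ T Fs ∧ st.reg z = Fs.length ∧
    ∀ x < Fs.length, st.mem a x = (Fs.take x).flatten.length

end RevLZ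

namespace RevLZ

/-! ## Suffix trees under the prepending of a letter -/

/-! Appending `c` to the text `X` prepends `c` to its reversal, so the online suffix tree indexes
`X.reverse`. If `M` is the part of the current factor read so far, the factor can be continued by
`c` exactly when `M ++ [c]` occurs in `c :: X.reverse`. The tree is therefore updated before the
match is tried, which accounts for self-references. Inverted copies are required of every prefix, so
a single failure rules out all longer candidates: greedy matching is correct, and closed factors
stay valid under any continuation (`Parse`, `Parse.extend`, `Parse.new_of_mem`,
`Parse.new_of_not_mem`).

The position of `M` in the tree is kept as its length and the closest node `u` at or below it.
Prepending a letter creates at most two nodes, the new leaf and the insertion point `g`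
(`IsInsertionPoint.isNode_cons`). Only a split of the edge above `u`, at or below `M`, can make `u`
obsolete, and then `g` takes its place (`IsLocusNode.cons_of_split`,
`IsLocusNode.cons_of_not_split`). To descend inside an edge, one letter of the label of `u` is
needed; it is read from the text through a stored occurrence of each node (`Index.getElem_node`). At
a node, a child query decides.

Each letter thus costs a constant number of tree operations and constant extra work. The private
data live beside the data of the tree routines, which cannot see them (`Exec.overlay`);
`run_processLetter` carries the invariant `Inv` over one letter. -/

theorem exists_branching_of_not_prefix {α : Type*} :
    ∀ {u v : List α}, ¬ u <+: v → ¬ v <+: u →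
      ∃ p a d, a ≠ d ∧ (p ++ [a]) <+: u ∧ (p ++ [d]) <+: v
  | [], v, h, _ => absurd List.nil_prefix h
  | _ :: _, [], _, h => absurd List.nil_prefix h
  | x :: u, y :: v, h₁, h₂ => by
    by_cases hxy : x = y
    · subst hxy
      rw [List.cons_prefix_cons] at h₁ h₂
      obtain ⟨p, a, d, had, hu, hv⟩ := exists_branching_of_not_prefix
        (fun h => h₁ ⟨rfl, h⟩) (fun h => h₂ ⟨rfl, h⟩)
      exact ⟨x :: p, a, d, had, by simpa using hu, by simpa using hv⟩
    · exact ⟨[], x, y, hxy, by simp, by simp⟩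

theorem eq_of_concat_prefix {α : Type*} {p u : List α} {a d : α} (ha : (p ++ [a]) <+: u)
    (hd : (p ++ [d]) <+: u) : a = d := by
  obtain ⟨x, rfl⟩ := ha
  obtain ⟨y, hy⟩ := hd
  simp at hy
  exact hy.1.symm

theorem IsNode.infix {S u : List ℕ} (h : IsNode S u) : u <:+: S := by
  rcases h with h | ⟨a, b, -, h, -⟩
  · exact h.isInfix
  · exact (List.prefix_append u [a]).isInfix.trans h

theorem isNode_nil (S : List ℕ) : IsNode S [] := Or.inl List.nil_suffix

theorem IsNode.cons {S u : List ℕ} (h : IsNode S u) (c : ℕ) : IsNode (c :: S) u := by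
  have hs := List.suffix_cons c S
  rcases h with h | ⟨a, b, hab, ha, hb⟩
  · exact Or.inl (h.trans hs)
  · exact Or.inr ⟨a, b, hab, ha.trans hs.isInfix, hb.trans hs.isInfix⟩

/-- There is no branching strictly between `M` and `u`: a divergence of `u` and `x` below `M` would
be a closer node, and one above `M` contradicts that both extend `M`. -/
theorem IsLocusNode.prefix_or_prefix {S M u x : List ℕ} (h : IsLocusNode S M u) (hx : x <:+: S)
    (hM : M <+: x) : u <+: x ∨ x <+: u := by
  by_contra! hne
  obtain ⟨p, a, d, had, hpu, hpx⟩ := exists_branching_of_not_prefix hne.1 hne.2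
  have hp : IsNode S p :=
    Or.inr ⟨a, d, had, hpu.isInfix.trans h.1.infix, hpx.isInfix.trans hx⟩
  have hlen := hpu.length_le
  simp only [List.length_append, List.length_singleton] at hlen
  by_cases hMp : M.length ≤ p.length
  · have := h.2.2 p hp
      (List.prefix_of_prefix_length_le h.2.1 ((List.prefix_append p [a]).trans hpu) hMp)
    omega
  · have h₁ := List.prefix_of_prefix_length_le hpu h.2.1 (by simp; omega)
    have h₂ := List.prefix_of_prefix_length_le hpx hM (by simp; omega)
    exact had (eq_of_concat_prefix h₁ h₂)

theorem IsInsertionPoint.isNode {S g : List ℕ} {c : ℕ} (h : IsInsertionPoint S c g) :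
    IsNode (c :: S) g := by
  obtain ⟨⟨t, ht⟩, ⟨x, y, hxy⟩, hmax⟩ := h
  have hS : S <:+: c :: S := (List.suffix_cons c S).isInfix
  -- If the occurrence of `g` ends where `S` ends, `g` is a suffix. Otherwise the letter after it
  -- differs from the next letter of `c :: S`, by maximality of `g`.
  cases y with
  | nil => exact Or.inl (List.IsSuffix.trans ⟨x, by simpa using hxy⟩ (List.suffix_cons c S))
  | cons d y =>
    have hd : (g ++ [d]) <:+: S := ⟨x, y, by simpa using hxy⟩
    cases t with
    | nil =>
      have h₁ := congrArg List.length ht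
      have h₂ := congrArg List.length hxy
      simp at h₁ h₂
      omega
    | cons a t =>
      have ha : (g ++ [a]) <+: c :: S := ⟨t, by simpa using ht⟩
      refine Or.inr ⟨a, d, ?_, ha.isInfix, hd.trans hS⟩
      rintro rfl
      have := hmax _ ha hd
      simp at this

theorem IsInsertionPoint.isNode_cons {S g v : List ℕ} {c : ℕ} (h : IsInsertionPoint S c g)
    (hv : IsNode (c :: S) v) : IsNode S v ∨ v = c :: S ∨ v = g := by
  -- A branching that is new relies on the new prefix: `v ++ [a]` does not occur in `S` while `v`
  -- does, so `v` is the longest old prefix.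
  have key : ∀ a d : ℕ, a ≠ d → (v ++ [a]) <+: c :: S → (v ++ [d]) <:+: S →
      IsNode S v ∨ v = g := by
    intro a d had ha hd
    by_cases haS : (v ++ [a]) <:+: S
    · exact Or.inl (Or.inr ⟨a, d, had, haS, hd⟩)
    · right
      have hvS : v <+: c :: S := (List.prefix_append v [a]).trans ha
      have hle := h.2.2 v hvS ((List.prefix_append v [d]).isInfix.trans hd)
      rcases hle.lt_or_eq with hlt | heq
      · exact absurd ((List.prefix_of_prefix_length_le ha h.1 (by simp; omega)).isInfix.trans
          h.2.1) haS
      · exact (List.prefix_of_prefix_length_le hvS h.1 hle).eq_of_length heq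
  rcases hv with hv | ⟨a, d, had, ha, hd⟩
  · rcases List.suffix_cons_iff.1 hv with hv | hv
    · exact Or.inr (Or.inl hv)
    · exact Or.inl (Or.inl hv)
  · rcases List.infix_cons_iff.1 ha with ha | ha <;> rcases List.infix_cons_iff.1 hd with hd | hd
    · exact absurd (eq_of_concat_prefix ha hd) had
    · exact (key a d had ha hd).imp_right Or.inr
    · exact (key d a had.symm hd ha).imp_right Or.inr
    · exact Or.inl (Or.inr ⟨a, d, had, ha, hd⟩)

/-- If the edge on which `M` lies is split at or below `M`, then the new inner node is the node
closest to `M`. -/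
theorem IsLocusNode.cons_of_split {S M u g : List ℕ} {c : ℕ} (h : IsLocusNode S M u)
    (hg : IsInsertionPoint S c g) (hu : IsLocusNode S g u) (hM : M.length ≤ g.length) :
    IsLocusNode (c :: S) M g := by
  refine ⟨hg.isNode, List.prefix_of_prefix_length_le h.2.1 hu.2.1 hM, fun v hv hMv => ?_⟩
  rcases hg.isNode_cons hv with hv | rfl | rfl
  · exact hu.2.1.length_le.trans (h.2.2 v hv hMv)
  · exact hg.1.length_le
  · exact le_rfl

/-- A new node below `M` forces `M <+: g`, since `M` occurs in `S` and `g` is the longest prefix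
that does. Then `g` is at or below `u`, or else on the edge above `u`, whence `u = b`, which `hM`
excludes. -/
theorem IsLocusNode.cons_of_not_split {S M u g b : List ℕ} {c : ℕ} (h : IsLocusNode S M u)
    (hg : IsInsertionPoint S c g) (hb : IsLocusNode S g b) (hM : u = b → g.length < M.length) :
    IsLocusNode (c :: S) M u := by
  have hug : M <+: g → u.length ≤ g.length := by
    intro hMg
    rcases h.prefix_or_prefix hg.2.1 hMg with hug | hgu
    · exact hug.length_le
    · have hlen : u.length = b.length :=
        le_antisymm (h.2.2 b hb.1 (hMg.trans hb.2.1)) (hb.2.2 u h.1 hgu)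
      have hub : u = b := by
        rcases h.prefix_or_prefix hb.1.infix (hMg.trans hb.2.1) with hx | hx
        · exact hx.eq_of_length hlen
        · exact (hx.eq_of_length hlen.symm).symm
      exact absurd hMg.length_le (not_le.2 (hM hub))
  refine ⟨h.1.cons c, h.2.1, fun v hv hMv => ?_⟩
  rcases hg.isNode_cons hv with hv | rfl | rfl
  · exact h.2.2 v hv hMv
  · have hMS : M <:+: S := h.2.1.isInfix.trans h.1.infix
    exact (hug (List.prefix_of_prefix_length_le hMv hg.1 (hg.2.2 M hMv hMS))).trans
      hg.1.length_le
  · exact hug hMv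

/-- Inside an edge, the next letter is determined by the lower end of the edge. -/
theorem IsLocusNode.concat_infix_iff {S M u : List ℕ} (h : IsLocusNode S M u)
    (hM : M.length < u.length) (c : ℕ) : (M ++ [c]) <:+: S ↔ u[M.length] = c := by
  have hu : (M ++ [u[M.length]]) <+: u := by
    obtain ⟨t, rfl⟩ := h.2.1
    cases t with
    | nil => simp at hM
    | cons a t => simp
  refine ⟨fun hc => ?_, fun hc => hc ▸ hu.isInfix.trans h.1.infix⟩
  by_contra hne
  -- A second continuation would make `M` itself a node, closer than `u`.
  have := h.2.2 M (Or.inr ⟨_, _, hne, hu.isInfix.trans h.1.infix, hc⟩) List.prefix_rfl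
  omega

theorem IsLocusNode.concat {S M u : List ℕ} (h : IsLocusNode S M u) {c : ℕ}
    (hM : M.length < u.length) (hc : u[M.length] = c) : IsLocusNode S (M ++ [c]) u := by
  refine ⟨h.1, ?_, fun v hv hMv => h.2.2 v hv ((List.prefix_append M [c]).trans hMv)⟩
  obtain ⟨t, rfl⟩ := h.2.1
  subst hc
  cases t with
  | nil => simp at hM
  | cons a t => simp

theorem isLocusNode_nil (S : List ℕ) : IsLocusNode S [] [] :=
  ⟨isNode_nil S, List.prefix_rfl, fun _ _ _ => Nat.zero_le _⟩

theorem IsLocusNode.infix {S M u : List ℕ} (h : IsLocusNode S M u) : M <:+: S :=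
  h.2.1.isInfix.trans h.1.infix

/-! ## The factorization of a growing text -/

theorem IsFactor.ne_nil {Q Z F : List ℕ} (h : IsFactor Q Z F) : F ≠ [] := by
  rcases h with ⟨c, -, rfl⟩ | ⟨⟨c, -, h⟩, -⟩
  · simp
  · rintro rfl
    simp at h

/-- The text `X` consists of the factors `Fs`, which are final whatever the continuation of the text
is, and of the part `M` of the factor that is being read. -/
structure Parse (X : List ℕ) (Fs : List (List ℕ)) (M : List ℕ) : Prop where
  flatten : Fs.flatten ++ M = X
  final : ∀ (Y : List ℕ) (x : ℕ) (hx : x < Fs.length),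
    IsFactor (Fs.take x).flatten ((Fs.drop x).flatten ++ (M ++ Y)) Fs[x]
  copies : HasInvertedCopies Fs.flatten M
  seen : M ≠ [] → ∃ c ∈ Fs.flatten, [c] <+: M

/-- The factors together with the one that is being read. -/
def allFactors (Fs : List (List ℕ)) (M : List ℕ) : List (List ℕ) :=
  if M = [] then Fs else Fs ++ [M]

theorem hasInvertedCopies_nil (Q : List ℕ) : HasInvertedCopies Q [] :=
  fun _ hne h => absurd (List.prefix_nil.1 h) hne

/-- The condition on a prefix never looks beyond that prefix, so only the newest one has to be
checked. -/
theorem HasInvertedCopies.concat {Q M : List ℕ} {c : ℕ} (h : HasInvertedCopies Q M)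
    (hc : (M ++ [c]).reverse <:+: Q ++ (M ++ [c])) : HasInvertedCopies Q (M ++ [c]) := by
  intro G hne hG
  rcases List.prefix_concat_iff.1 hG with rfl | hG
  · exact hc
  · exact h G hne hG

theorem parse_nil : Parse [] [] [] :=
  ⟨rfl, fun _ _ hx => absurd hx (by simp), hasInvertedCopies_nil _, fun h => absurd rfl h⟩

theorem final_append {Fs : List (List ℕ)} {M Z : List ℕ}
    (h : ∀ (x : ℕ) (hx : x < Fs.length),
      IsFactor (Fs.take x).flatten ((Fs.drop x).flatten ++ (M ++ Z)) Fs[x])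
    (hM : IsFactor Fs.flatten (M ++ Z) M) (x : ℕ) (hx : x < (Fs ++ [M]).length) :
    IsFactor ((Fs ++ [M]).take x).flatten (((Fs ++ [M]).drop x).flatten ++ Z) (Fs ++ [M])[x] := by
  rcases Nat.lt_or_ge x Fs.length with hlt | hge
  · rw [List.take_append_of_le_length hlt.le, List.drop_append_of_le_length hlt.le,
      List.getElem_append_left hlt]
    simpa using h x hlt
  · obtain rfl : x = Fs.length := by simp at hx; omega
    simpa using hM

theorem Parse.isOverlapRevLZ {X M : List ℕ} {Fs : List (List ℕ)} (h : Parse X Fs M) :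
    IsOverlapRevLZ X (allFactors Fs M) := by
  unfold allFactors
  split_ifs with hM
  · subst hM
    refine ⟨by simpa using h.flatten, fun x hx => by simpa using h.final [] x hx⟩
  · refine ⟨by simpa using h.flatten, fun x hx => ?_⟩
    have := final_append (Z := []) (h.final [])
      (Or.inr ⟨h.seen hM, h.copies, fun G hG _ => by simpa using hG.length_le⟩) x hx
    simpa using this

theorem length_le_length_flatten {α : Type*} (Fs : List (List α)) (h : ∀ F ∈ Fs, F ≠ []) :
    Fs.length ≤ Fs.flatten.length := by
  induction Fs with
  | nil => simp
  | cons F Fs ih =>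
    have h₁ := List.length_pos_iff.2 (h F (by simp))
    have h₂ := ih fun G hG => h G (by simp [hG])
    simp only [List.length_cons, List.flatten_cons, List.length_append]
    omega

theorem IsOverlapRevLZ.length_le {T : List ℕ} {Fs : List (List ℕ)} (h : IsOverlapRevLZ T Fs) :
    Fs.length ≤ T.length := by
  rw [← h.1]
  refine length_le_length_flatten Fs fun F hF => ?_
  obtain ⟨x, hx, rfl⟩ := List.getElem_of_mem hF
  exact (h.2 x hx).ne_nil

theorem Parse.extend {X M : List ℕ} {Fs : List (List ℕ)} (h : Parse X Fs M) (hM : M ≠ []) {c : ℕ}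
    (hc : (M ++ [c]) <:+: c :: X.reverse) : Parse (X ++ [c]) Fs (M ++ [c]) := by
  refine ⟨by simp [← h.flatten], fun Y x hx => by simpa using h.final ([c] ++ Y) x hx,
    h.copies.concat ?_, fun _ => ?_⟩
  · rw [← List.append_assoc, h.flatten, ← List.reverse_infix]
    simpa using hc
  · obtain ⟨d, hd, hp⟩ := h.seen hM
    exact ⟨d, hd, hp.trans (List.prefix_append M [c])⟩

/-- After a mismatch `M` is maximal whatever follows: a longer candidate has `M ++ [c]` as a prefix,
whose inverted copy is missing. -/
theorem Parse.final_allFactors {X M : List ℕ} {Fs : List (List ℕ)} (h : Parse X Fs M) {c : ℕ}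
    (hc : M ≠ [] → ¬ (M ++ [c]) <:+: c :: X.reverse) (Y : List ℕ) (x : ℕ)
    (hx : x < (allFactors Fs M).length) :
    IsFactor ((allFactors Fs M).take x).flatten
      (((allFactors Fs M).drop x).flatten ++ ([c] ++ Y)) (allFactors Fs M)[x] := by
  by_cases hM : M = []
  · subst hM
    simpa [allFactors] using h.final ([c] ++ Y) x (by simpa [allFactors] using hx)
  · have hall : allFactors Fs M = Fs ++ [M] := if_neg hM
    simp only [hall] at hx ⊢
    refine final_append (h.final ([c] ++ Y)) (Or.inr ⟨h.seen hM, h.copies, fun G hG hcop => ?_⟩) x hx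
    by_contra! hlt
    refine hc hM ?_
    have hcG : (M ++ [c]) <+: G :=
      List.prefix_of_prefix_length_le ⟨Y, by simp⟩ hG (by simpa using hlt)
    have := hcop _ (by simp) hcG
    rw [← List.append_assoc, h.flatten, ← List.reverse_infix] at this
    simpa using this

theorem Parse.flatten_allFactors {X M : List ℕ} {Fs : List (List ℕ)} (h : Parse X Fs M) :
    (allFactors Fs M).flatten = X := h.isOverlapRevLZ.1

theorem Parse.new_of_mem {X M : List ℕ} {Fs : List (List ℕ)} (h : Parse X Fs M) {c : ℕ}
    (hc : M ≠ [] → ¬ (M ++ [c]) <:+: c :: X.reverse) (hmem : c ∈ X) :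
    Parse (X ++ [c]) (allFactors Fs M) [c] := by
  refine ⟨by rw [h.flatten_allFactors], h.final_allFactors hc,
    -- A single letter is its own inverted copy, by self-reference.
    (hasInvertedCopies_nil _).concat (c := c)
      (by simpa using (List.suffix_append _ [c]).isInfix), fun _ => ⟨c, ?_, List.prefix_rfl⟩⟩
  rwa [h.flatten_allFactors]

theorem Parse.new_of_not_mem {X M : List ℕ} {Fs : List (List ℕ)} (h : Parse X Fs M) {c : ℕ}
    (hc : M ≠ [] → ¬ (M ++ [c]) <:+: c :: X.reverse) (hmem : c ∉ X) :
    Parse (X ++ [c]) (allFactors Fs M ++ [[c]]) [] := by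
  refine ⟨by simp [h.flatten_allFactors], fun Y x hx => ?_, hasInvertedCopies_nil _,
    fun h => absurd rfl h⟩
  refine final_append (Z := [] ++ Y) (fun y hy => ?_) (Or.inl ⟨c, ?_, rfl⟩) x hx
  · simpa using h.final_allFactors hc Y y hy
  · rwa [h.flatten_allFactors]

/-! ## Running programs -/

/-- The program `c` started in `st` halts with running time and final state satisfying `Q`. -/
def Run (w m : ℕ) (c : Cmd) (st : State) (Q : ℕ → State → Prop) : Prop :=
  ∃ k st', Exec w m c st k st' ∧ Q k st'

theorem Exec.pos {w m k : ℕ} {c : Cmd} {st st' : State} (h : Exec w m c st k st') : 0 < k := by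
  induction h <;> omega

theorem Exec.mono {w m m' k : ℕ} {c : Cmd} {st st' : State} (h : Exec w m c st k st')
    (hm : m ≤ m') : Exec w m' c st k st' := by
  induction h with
  | skip st => exact .skip st
  | assign r e st => exact .assign r e st
  | load r a e st h => exact .load r a e st (h.trans_le hm)
  | store a e₁ e₂ st h => exact .store a e₁ e₂ st (h.trans_le hm)
  | seq c₁ c₂ st st₁ st₂ k₁ k₂ _ _ ih₁ ih₂ => exact .seq _ _ _ _ _ _ _ ih₁ ih₂
  | ite_true e c₁ c₂ st st' k he _ ih => exact .ite_true _ _ _ _ _ _ he ih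
  | ite_false e c₁ c₂ st st' k he _ ih => exact .ite_false _ _ _ _ _ _ he ih
  | loop_step e c st st₁ st₂ k₁ k₂ he _ _ ih₁ ih₂ => exact .loop_step _ _ _ _ _ _ _ he ih₁ ih₂
  | _ e c st he =>
    constructor
    exact he

section Rules

variable {w m : ℕ} {st : State} {Q : ℕ → State → Prop}

theorem Run.imp {c : Cmd} {Q' : ℕ → State → Prop} (h : Run w m c st Q)
    (hQ : ∀ k st', Q k st' → Q' k st') : Run w m c st Q' :=
  let ⟨k, st', h₁, h₂⟩ := h
  ⟨k, st', h₁, hQ k st' h₂⟩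

theorem Run.skip (h : Q 1 st) : Run w m .skip st Q := ⟨_, _, .skip _, h⟩

theorem Run.assign {r : ℕ} {e : Expr} (h : Q (e.cost + 1) (st.setReg r (e.eval w st))) :
    Run w m (.assign r e) st Q := ⟨_, _, .assign _ _ _, h⟩

theorem Run.load {r a : ℕ} {e : Expr} (hm : e.eval w st < m)
    (h : Q (e.cost + 1) (st.setReg r (st.mem a (e.eval w st)))) :
    Run w m (.load r a e) st Q := ⟨_, _, .load _ _ _ _ hm, h⟩

theorem Run.store {a : ℕ} {e₁ e₂ : Expr} (hm : e₁.eval w st < m)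
    (h : Q (e₁.cost + e₂.cost + 1) (st.setMem a (e₁.eval w st) (e₂.eval w st))) :
    Run w m (.store a e₁ e₂) st Q := ⟨_, _, .store _ _ _ _ hm, h⟩

theorem Run.seq {c₁ c₂ : Cmd}
    (h : Run w m c₁ st fun k₁ st₁ => Run w m c₂ st₁ fun k₂ st₂ => Q (k₁ + k₂) st₂) :
    Run w m (.seq c₁ c₂) st Q :=
  let ⟨_, _, h₁, _, _, h₂, hQ⟩ := h
  ⟨_, _, .seq _ _ _ _ _ _ _ h₁ h₂, hQ⟩

theorem Run.ite {e : Expr} {c₁ c₂ : Cmd}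
    (h₁ : e.eval w st ≠ 0 → Run w m c₁ st fun k st' => Q (e.cost + k + 1) st')
    (h₂ : e.eval w st = 0 → Run w m c₂ st fun k st' => Q (e.cost + k + 1) st') :
    Run w m (.ite e c₁ c₂) st Q := by
  by_cases he : e.eval w st = 0
  · obtain ⟨_, _, h, hQ⟩ := h₂ he
    exact ⟨_, _, .ite_false _ _ _ _ _ _ he h, hQ⟩
  · obtain ⟨_, _, h, hQ⟩ := h₁ he
    exact ⟨_, _, .ite_true _ _ _ _ _ _ he h, hQ⟩

end Rules

/-! ## Running a program beside private registers and arrays -/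

/-- A bound on the registers that occur in an expression. -/
def Expr.bound : Expr → ℕ
  | .const _ => 0
  | .wordSize => 0
  | .reg r => r + 1
  | .op _ e₁ e₂ => max e₁.bound e₂.bound

/-- A bound on the registers and arrays that occur in a program. -/
def Cmd.bound : Cmd → ℕ
  | .skip => 0
  | .assign r e => max (r + 1) e.bound
  | .load r a e => max (max (r + 1) (a + 1)) e.bound
  | .store a e₁ e₂ => max (a + 1) (max e₁.bound e₂.bound)
  | .seq c₁ c₂ => max c₁.bound c₂.bound
  | .ite e c₁ c₂ => max e.bound (max c₁.bound c₂.bound)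
  | .loop e c => max e.bound c.bound

/-- The registers and arrays below `N` are those of `a`; above them come those of `b`. -/
def overlay (N : ℕ) (a b : State) : State where
  reg r := if r < N then a.reg r else b.reg (r - N)
  mem i := if i < N then a.mem i else b.mem (i - N)

section Overlay

variable {N : ℕ} (a b : State)

theorem overlay_zero : overlay N .zero .zero = .zero := by
  simp [overlay, State.zero]

@[simp] theorem overlay_reg_add (i : ℕ) : (overlay N a b).reg (N + i) = b.reg i := by
  simp [overlay]

theorem overlay_reg_of_lt {r : ℕ} (h : r < N) : (overlay N a b).reg r = a.reg r := by
  simp [overlay, h]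

@[simp] theorem overlay_mem_add (i : ℕ) : (overlay N a b).mem (N + i) = b.mem i := by
  simp [overlay]

theorem overlay_mem_of_lt {r : ℕ} (h : r < N) : (overlay N a b).mem r = a.mem r := by
  simp [overlay, h]

@[simp] theorem overlay_setReg_add (i v : ℕ) :
    (overlay N a b).setReg (N + i) v = overlay N a (b.setReg i v) := by
  simp only [overlay, State.setReg, State.mk.injEq, and_true]
  funext r
  simp only [Function.update_apply]
  split_ifs <;> first | rfl | omega

theorem overlay_setReg_of_lt {r : ℕ} (h : r < N) (v : ℕ) :
    (overlay N a b).setReg r v = overlay N (a.setReg r v) b := by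
  simp only [overlay, State.setReg, State.mk.injEq, and_true]
  funext r
  simp only [Function.update_apply]
  split_ifs <;> first | rfl | omega

@[simp] theorem overlay_setMem_add (i x v : ℕ) :
    (overlay N a b).setMem (N + i) x v = overlay N a (b.setMem i x v) := by
  simp only [overlay, State.setMem, State.mk.injEq, true_and]
  funext r
  simp only [Function.update_apply]
  split_ifs <;> first | rfl | omega | simp

theorem overlay_setMem_of_lt {i : ℕ} (h : i < N) (x v : ℕ) :
    (overlay N a b).setMem i x v = overlay N (a.setMem i x v) b := by
  simp only [overlay, State.setMem, State.mk.injEq, true_and]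
  funext r
  simp only [Function.update_apply]
  split_ifs <;> first | rfl | omega

theorem Expr.eval_overlay (w : ℕ) {e : Expr} (he : e.bound ≤ N) :
    e.eval w (overlay N a b) = e.eval w a := by
  induction e with
  | const v => rfl
  | wordSize => rfl
  | reg r => exact overlay_reg_of_lt a b he
  | op o e₁ e₂ ih₁ ih₂ =>
    simp only [Expr.bound, max_le_iff] at he
    simp only [Expr.eval, ih₁ he.1, ih₂ he.2]

/-- A program cannot read or write above its bound. So `a` can be a ghost state on which the tree
invariant holds, although its part above `N` is hidden on the real machine. -/
theorem Exec.overlay {w m k : ℕ} {c : Cmd} {a a' : State} (h : Exec w m c a k a')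
    (hc : c.bound ≤ N) (b : State) :
    Exec w m c (overlay N a b) k (overlay N a' b) := by
  induction h with
  | skip st => exact .skip _
  | assign r e st =>
    simp only [Cmd.bound, max_le_iff] at hc
    have := Exec.assign (w := w) (m := m) r e (RevLZ.overlay N st b)
    rwa [Expr.eval_overlay _ _ _ hc.2, overlay_setReg_of_lt _ _ hc.1] at this
  | load r i e st h =>
    simp only [Cmd.bound, max_le_iff] at hc
    have := Exec.load (w := w) (m := m) r i e (RevLZ.overlay N st b)
    rw [Expr.eval_overlay _ _ _ hc.2, overlay_setReg_of_lt _ _ hc.1.1,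
      overlay_mem_of_lt _ _ hc.1.2] at this
    exact this h
  | store i e₁ e₂ st h =>
    simp only [Cmd.bound, max_le_iff] at hc
    have := Exec.store (w := w) (m := m) i e₁ e₂ (RevLZ.overlay N st b)
    rw [Expr.eval_overlay _ _ _ hc.2.1, Expr.eval_overlay _ _ _ hc.2.2,
      overlay_setMem_of_lt _ _ hc.1] at this
    exact this h
  | seq c₁ c₂ st st₁ st₂ k₁ k₂ _ _ ih₁ ih₂ =>
    simp only [Cmd.bound, max_le_iff] at hc
    exact .seq _ _ _ _ _ _ _ (ih₁ hc.1) (ih₂ hc.2)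
  | ite_true e c₁ c₂ st st' k he _ ih =>
    simp only [Cmd.bound, max_le_iff] at hc
    exact .ite_true _ _ _ _ _ _ (by rwa [Expr.eval_overlay _ _ _ hc.1]) (ih hc.2.1)
  | ite_false e c₁ c₂ st st' k he _ ih =>
    simp only [Cmd.bound, max_le_iff] at hc
    exact .ite_false _ _ _ _ _ _ (by rwa [Expr.eval_overlay _ _ _ hc.1]) (ih hc.2.2)
  | loop_step e c st st₁ st₂ k₁ k₂ he _ _ ih₁ ih₂ =>
    have hc' := hc
    simp only [Cmd.bound, max_le_iff] at hc'
    exact .loop_step _ _ _ _ _ _ _ (by rwa [Expr.eval_overlay _ _ _ hc'.1]) (ih₁ hc'.2) (ih₂ hc)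
  | _ e c st he =>
    simp only [Cmd.bound, max_le_iff] at hc
    constructor
    rwa [Expr.eval_overlay _ _ _ hc.1]

end Overlay

/-! ## Words -/

section Words

variable {w x y : ℕ}

theorem BinOp.eval_add_of_lt (h : x + y < 2 ^ w) : BinOp.add.eval w x y = x + y :=
  Nat.mod_eq_of_lt h

theorem BinOp.eval_sub_of_le (hx : x < 2 ^ w) (h : y ≤ x) : BinOp.sub.eval w x y = x - y := by
  have : x + (2 ^ w - y) = (x - y) + 2 ^ w := by omega
  rw [BinOp.eval, this, Nat.add_mod_right, Nat.mod_eq_of_lt (by omega)]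

theorem BinOp.eval_mul_of_lt (h : x * y < 2 ^ w) : BinOp.mul.eval w x y = x * y :=
  Nat.mod_eq_of_lt h

theorem BinOp.eval_eq (hw : 1 < 2 ^ w) : BinOp.eq.eval w x y = if x = y then 1 else 0 := by
  rw [BinOp.eval]
  split_ifs
  · exact Nat.mod_eq_of_lt hw
  · exact Nat.zero_mod _

theorem BinOp.eval_lt (hw : 1 < 2 ^ w) : BinOp.lt.eval w x y = if x < y then 1 else 0 := by
  rw [BinOp.eval]
  split_ifs
  · exact Nat.mod_eq_of_lt hw
  · exact Nat.zero_mod _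

end Words

@[simp] theorem State.setReg_setReg (st : State) (r x y : ℕ) :
    (st.setReg r x).setReg r y = st.setReg r y := by
  simp [State.setReg]

@[simp] theorem State.setReg_self (st : State) (r : ℕ) : st.setReg r (st.reg r) = st := by
  simp [State.setReg]

theorem State.reg_setReg (st : State) (r v i : ℕ) :
    (st.setReg r v).reg i = if i = r then v else st.reg i := by
  simp [State.setReg, Function.update_apply]

@[simp] theorem State.mem_setReg (st : State) (r v : ℕ) : (st.setReg r v).mem = st.mem := rfl

@[simp] theorem State.reg_setMem (st : State) (a i v : ℕ) : (st.setMem a i v).reg = st.reg := rfl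

theorem State.mem_setMem (st : State) (a i v x y : ℕ) :
    (st.setMem a i v).mem x y = if x = a ∧ y = i then v else st.mem x y := by
  simp only [State.setMem, Function.update_apply]
  split_ifs <;> simp_all

/-! ## Calls of the suffix tree routines -/

/-- Query the child of node `e₁` by the letter `e₂`. -/
def callChild (D : SuffixTreeProgram) (e₁ e₂ : Expr) : Cmd :=
  .seq (.assign 0 e₁) (.seq (.assign 1 e₂) D.child)

/-- Query the depth of node `e`. -/
def callDepth (D : SuffixTreeProgram) (e : Expr) : Cmd :=
  .seq (.assign 0 e) D.depth

section Calls

variable {D : SuffixTreeProgram} {w n σ τ s m N : ℕ} {Rep : List ℕ → (List ℕ → ℕ) → State → Prop}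
  {S : List ℕ} {addr : List ℕ → ℕ} {a a₀ b : State} {u : List ℕ} {Q : ℕ → State → Prop}

/-- The states `a₀` and `a` may differ in register `0`, which holds the input letter when a step
starts and is overwritten by the call. -/
theorem run_callChild (hD : D.Maintains w n σ τ s Rep) (hN : D.child.bound ≤ N) (hN₃ : 3 ≤ N)
    (hR : Rep S addr a) (ha : ∀ x, a₀.setReg 0 x = a.setReg 0 x) (hu : IsNode S u) {c : ℕ}
    (hc : c < σ) (hm : s * (S.length + 1) ≤ m) {e₁ e₂ : Expr}
    (he₁ : e₁.eval w (overlay N a₀ b) = addr u)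
    (he₂ : e₂.eval w (overlay N (a.setReg 0 (addr u)) b) = c)
    (hQ : ∀ k a', k ≤ τ → Rep S addr a' →
      ((∃ v, IsLocusNode S (u ++ [c]) v ∧ a'.reg 0 = 1 ∧ a'.reg 1 = addr v) ∨
        (¬ (u ++ [c]) <:+: S ∧ a'.reg 0 = 0)) →
      Q (e₁.cost + 1 + (e₂.cost + 1 + k)) (overlay N a' b)) :
    Run w m (callChild D e₁ e₂) (overlay N a₀ b) Q := by
  obtain ⟨k, hk, a', hex, hR', hres⟩ := hD.child S addr a u c hR hu hc
  refine .seq (.assign ?_)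
  rw [he₁, overlay_setReg_of_lt _ _ (by omega), ha]
  refine .seq (.assign ?_)
  rw [he₂, overlay_setReg_of_lt _ _ (by omega)]
  exact ⟨k, _, (hex.overlay hN b).mono hm, hQ k a' hk hR' hres⟩

theorem run_callDepth (hD : D.Maintains w n σ τ s Rep) (hN : D.depth.bound ≤ N) (hN₃ : 3 ≤ N)
    (hR : Rep S addr a) (hu : IsNode S u) (hm : s * (S.length + 1) ≤ m) {e : Expr}
    (he : e.eval w (overlay N a b) = addr u)
    (hQ : ∀ k a', k ≤ τ → Rep S addr a' → a'.reg 0 = u.length →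
      Q (e.cost + 1 + k) (overlay N a' b)) :
    Run w m (callDepth D e) (overlay N a b) Q := by
  obtain ⟨k, hk, a', hex, hR', hres⟩ := hD.depth S addr a u hR hu
  refine .seq (.assign ?_)
  rw [he, overlay_setReg_of_lt _ _ (by omega)]
  exact ⟨k, _, (hex.overlay hN b).mono hm, hQ k a' hk hR' hres⟩

end Calls

/-! ## The program

Private registers, counted from `N`: `1` the current letter, `2` the number of letters read, `3` the
number of factors, `4` the length of the matched part `M` of the current factor (`0` after the first
occurrence of a letter), `5` the suffix tree node closest to `M`, `6` whether the current letter
has occurred before, `7` and `8` auxiliary values.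

Private arrays, counted from `N`: `1` the text, `2` for each node the end of an occurrence of its
reversed label in the text, `3` the starting positions of the factors. -/

section Program

variable (D : SuffixTreeProgram) (N : ℕ)

/-- Store the current letter and find out whether it has occurred before. -/
def readLetter : Cmd :=
  .seq (.assign (N + 1) (.reg 0))
    (.seq (callChild D (.const 0) (.reg (N + 1))) (.assign (N + 6) (.reg 0)))

/-- Extend the suffix tree, the text, and the occurrences of the nodes. -/
def extendTree : Cmd :=
  .seq (.assign 0 (.reg (N + 1))) (.seq D.update
    (.seq (.store (N + 1) (.reg (N + 2)) (.reg (N + 1)))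
    (.seq (.assign (N + 2) (.op .add (.reg (N + 2)) (.const 1)))
    (.seq (.store (N + 2) (.reg 0) (.reg (N + 2))) (.store (N + 2) (.reg 1) (.reg (N + 2)))))))

/-- Adapt the node closest to `M` to the new suffix tree. -/
def moveLocus : Cmd :=
  .seq (.assign (N + 7) (.reg 1)) (.seq (.assign (N + 8) (.reg 2))
    (.seq (callDepth D (.reg 1))
    (.ite (.op .eq (.reg (N + 5)) (.reg (N + 8)))
      (.ite (.op .lt (.reg 0) (.reg (N + 4))) .skip (.assign (N + 5) (.reg (N + 7)))) .skip)))

/-- Try to descend from `M` by the current letter. -/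
def matchLetter : Cmd :=
  .seq (callDepth D (.reg (N + 5)))
    (.ite (.op .lt (.reg (N + 4)) (.reg 0))
      (.seq (.load (N + 8) (N + 2) (.reg (N + 5)))
        (.seq (.load (N + 8) (N + 1)
          (.op .sub (.op .sub (.reg (N + 8)) (.const 1)) (.reg (N + 4))))
        (.assign (N + 8) (.op .eq (.reg (N + 8)) (.reg (N + 1))))))
      (.seq (callChild D (.reg (N + 5)) (.reg (N + 1)))
        (.seq (.assign (N + 8) (.reg 0)) (.assign (N + 5) (.reg 1)))))

/-- Extend the current factor or begin a new one. -/
def emitFactor : Cmd :=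
  .ite (.op .mul (.reg (N + 4)) (.reg (N + 8)))
    (.assign (N + 4) (.op .add (.reg (N + 4)) (.const 1)))
    (.seq (.store (N + 3) (.reg (N + 3)) (.op .sub (.reg (N + 2)) (.const 1)))
      (.seq (.assign (N + 3) (.op .add (.reg (N + 3)) (.const 1)))
      (.ite (.reg (N + 6))
        (.seq (callChild D (.const 0) (.reg (N + 1)))
          (.seq (.assign (N + 5) (.reg 1)) (.assign (N + 4) (.const 1))))
        (.seq (.assign (N + 4) (.const 0)) (.assign (N + 5) (.const 0))))))

/-- The work for one letter. -/
def processLetter : Cmd :=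
  .seq (readLetter D N) (.seq (extendTree D N)
    (.seq (moveLocus D N) (.seq (matchLetter D N) (emitFactor D N))))

end Program

/-- The private arrays `1` and `2` hold the text and an occurrence of each node. -/
structure Index (X : List ℕ) (addr : List ℕ → ℕ) (b : State) : Prop where
  text : ∀ (i : ℕ) (hi : i < X.length), b.mem 1 i = X[i]
  le_occ : ∀ v, IsNode X.reverse v → v.length ≤ b.mem 2 (addr v)
  occ_le : ∀ v, IsNode X.reverse v → b.mem 2 (addr v) ≤ X.length
  prefix_occ : ∀ v, IsNode X.reverse v → v <+: (X.take (b.mem 2 (addr v))).reverse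

/-! ### Specifications of the stages that process one letter -/

section Spec

variable {D : SuffixTreeProgram} {w n σ τ s m N : ℕ} {Rep : List ℕ → (List ℕ → ℕ) → State → Prop}
  {S : List ℕ} {addr : List ℕ → ℕ} {a b : State} {c : ℕ}

theorem run_readLetter (hD : D.Maintains w n σ τ s Rep) (hN : D.child.bound ≤ N) (hN₃ : 3 ≤ N)
    (hR : Rep S addr a) (hc : c < σ) (hm : s * (S.length + 1) ≤ m) :
    Run w m (readLetter D N) (overlay N (a.setReg 0 c) b) fun k st => k ≤ τ + 10 ∧
      ∃ a', Rep S addr a' ∧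
        st = overlay N a' ((b.setReg 1 c).setReg 6 (if c ∈ S then 1 else 0)) := by
  refine .seq (.assign (.seq ?_))
  simp only [Expr.eval, overlay_setReg_add, Expr.cost]
  rw [overlay_reg_of_lt _ _ (by omega)]
  refine run_callChild hD hN hN₃ hR (by simp) (isNode_nil S) hc hm ?_ ?_ ?_
  · simp [Expr.eval, (hD.address _ _ _ hR).1]
  · simp [Expr.eval, State.reg_setReg]
  · intro k a' hk hR' hres
    refine .assign ?_
    simp only [Expr.eval, overlay_setReg_add, Expr.cost]
    rw [overlay_reg_of_lt _ _ (by omega)]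
    refine ⟨by omega, a', hR', ?_⟩
    have hmem : a'.reg 0 = if c ∈ S then 1 else 0 := by
      rcases hres with ⟨v, hv, h, -⟩ | ⟨hv, h⟩
      · rw [h, if_pos]
        exact hv.infix.subset (by simp)
      · rw [h, if_neg]
        intro hcS
        obtain ⟨x, y, rfl⟩ := List.append_of_mem hcS
        exact hv ⟨x, y, by simp⟩
    simp [State.reg_setReg, hmem]

theorem run_extendTree (hD : D.Maintains w n σ τ s Rep) (hN : D.update.bound ≤ N) (hN₃ : 3 ≤ N)
    (hw : 1 < 2 ^ w) (hR : Rep S addr a) (hc : c < σ) (hS : S.length < n)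
    (hSw : S.length + 1 < 2 ^ w) (hm : s * (S.length + 2) ≤ m) (hSm : S.length < m)
    (hb₁ : b.reg 1 = c) (hb₂ : b.reg 2 = S.length) :
    Run w m (extendTree D N) (overlay N a b) fun k st => k ≤ τ + 20 ∧
      ∃ a' addr' g l, Rep (c :: S) addr' a' ∧ (∀ u, IsNode S u → addr' u = addr u) ∧
        IsInsertionPoint S c g ∧ IsLocusNode S g l ∧ a'.reg 1 = addr' g ∧ a'.reg 2 = addr' l ∧
        st = overlay N a' ((((b.setMem 1 S.length c).setReg 2 (S.length + 1)).setMem 2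
          (addr' (c :: S)) (S.length + 1)).setMem 2 (addr' g) (S.length + 1)) := by
  obtain ⟨k, hk, a', addr', hex, hR', hold, g, l, hg, hl, h₀, h₁, h₂⟩ :=
    hD.update S addr a c hR hc hS
  have haddr := (hD.address _ _ _ hR').2.1
  simp only [List.length_cons] at haddr
  refine .seq (.assign (.seq ?_))
  simp only [Expr.eval, overlay_reg_add, hb₁]
  rw [overlay_setReg_of_lt _ _ (by omega)]
  refine ⟨k, _, (hex.overlay hN b).mono hm, ?_⟩
  refine .seq (.store (by simpa [Expr.eval, hb₂] using hSm) (.seq (.assign ?_)))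
  simp only [Expr.eval, overlay_reg_add, overlay_setMem_add, overlay_setReg_add, hb₁, hb₂,
    State.reg_setMem, Nat.mod_eq_of_lt hw, BinOp.eval_add_of_lt hSw]
  refine .seq (.store ?_ (.store ?_ ?_))
  · rw [Expr.eval, overlay_reg_of_lt _ _ (by omega), h₀]
    exact (haddr _ (Or.inl List.suffix_rfl)).trans_le hm
  · simp only [Expr.eval, overlay_setMem_add]
    rw [overlay_reg_of_lt _ _ (by omega), h₁]
    exact (haddr _ hg.isNode).trans_le hm
  · simp only [Expr.eval, overlay_setMem_add, Expr.cost]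
    rw [overlay_reg_of_lt (r := 0) _ _ (by omega), overlay_reg_of_lt (r := 1) _ _ (by omega), h₀, h₁]
    refine ⟨by omega, a', addr', g, l, hR', hold, hg, hl, h₁, h₂, ?_⟩
    simp [State.reg_setReg]

/-- The leaf and `g` are prefixes of the whole reversed text, so the end of the text serves as their
occurrence. All other nodes are old, and by injectivity of addresses their entries are untouched. -/
theorem Index.extend {X : List ℕ} (h : Index X addr b) {addr' : List ℕ → ℕ} {g : List ℕ}
    (hold : ∀ u, IsNode X.reverse u → addr' u = addr u)
    (hinj : ∀ u v, IsNode (c :: X.reverse) u → IsNode (c :: X.reverse) v → addr' u = addr' v → u = v)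
    (hg : IsInsertionPoint X.reverse c g) :
    Index (X ++ [c]) addr' ((((b.setMem 1 X.length c).setReg 2 (X.length + 1)).setMem 2
      (addr' (c :: X.reverse)) (X.length + 1)).setMem 2 (addr' g) (X.length + 1)) := by
  set b' := ((((b.setMem 1 X.length c).setReg 2 (X.length + 1)).setMem 2
      (addr' (c :: X.reverse)) (X.length + 1)).setMem 2 (addr' g) (X.length + 1)) with hb'
  have key : ∀ v, IsNode (c :: X.reverse) v →
      (v <+: c :: X.reverse ∧ b'.mem 2 (addr' v) = X.length + 1) ∨
        (IsNode X.reverse v ∧ b'.mem 2 (addr' v) = b.mem 2 (addr v)) := by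
    intro v hv
    by_cases h₁ : v = g
    · left
      subst h₁
      exact ⟨hg.1, by simp [hb', State.mem_setMem]⟩
    by_cases h₂ : v = c :: X.reverse
    · left
      subst h₂
      exact ⟨List.prefix_rfl, by simp [hb', State.mem_setMem]⟩
    have hvX : IsNode X.reverse v := by
      rcases hg.isNode_cons hv with h | h | h
      · exact h
      · exact absurd h h₂
      · exact absurd h h₁
    right
    refine ⟨hvX, ?_⟩
    have h₁' : addr' v ≠ addr' g := fun h => h₁ (hinj _ _ hv hg.isNode h)
    have h₂' : addr' v ≠ addr' (c :: X.reverse) :=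
      fun h => h₂ (hinj _ _ hv (Or.inl List.suffix_rfl) h)
    rw [← hold v hvX]
    simp [hb', State.mem_setMem, h₁', h₂']
  have hrev : (X ++ [c]).reverse = c :: X.reverse := by simp
  refine ⟨fun i hi => ?_, fun v hv => ?_, fun v hv => ?_, fun v hv => ?_⟩
  · simp only [hb', State.mem_setMem, State.mem_setReg, List.getElem_append]
    simp only [List.length_append, List.length_singleton] at hi
    by_cases hiX : i < X.length
    · simp [hiX, hiX.ne, h.text i hiX]
    · obtain rfl : i = X.length := by omega
      simp
  all_goals rw [hrev] at hv; rcases key v hv with ⟨hp, he⟩ | ⟨hvX, he⟩ <;> rw [he]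
  · simpa using hp.length_le
  · exact h.le_occ v hvX
  · simp
  · exact (h.occ_le v hvX).trans (by simp)
  · rwa [List.take_of_length_le (by simp), hrev]
  · rw [List.take_append_of_le_length (h.occ_le v hvX)]
    exact h.prefix_occ v hvX

theorem run_moveLocus (hD : D.Maintains w n σ τ s Rep) (hN : D.depth.bound ≤ N) (hN₃ : 3 ≤ N)
    (hw : 1 < 2 ^ w) (hR : Rep (c :: S) addr a) (hm : s * (S.length + 2) ≤ m) {M u g l : List ℕ}
    (hu : IsLocusNode S M u) (hg : IsInsertionPoint S c g) (hl : IsLocusNode S g l)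
    (ha₁ : a.reg 1 = addr g) (ha₂ : a.reg 2 = addr l) (hb₄ : b.reg 4 = M.length)
    (hb₅ : b.reg 5 = addr u) :
    Run w m (moveLocus D N) (overlay N a b) fun k st => k ≤ τ + 30 ∧
      ∃ a' u', Rep (c :: S) addr a' ∧ IsLocusNode (c :: S) M u' ∧
        st = overlay N a' (((b.setReg 7 (addr g)).setReg 8 (addr l)).setReg 5 (addr u')) := by
  have hinj := (hD.address _ _ _ hR).2.2
  refine .seq (.assign (.seq (.assign (.seq ?_))))
  simp only [Expr.eval, overlay_setReg_add]
  rw [overlay_reg_of_lt _ _ (by omega), overlay_reg_of_lt _ _ (by omega), ha₁, ha₂]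
  refine run_callDepth hD hN hN₃ hR hg.isNode hm ?_ ?_
  · rw [Expr.eval, overlay_reg_of_lt _ _ (by omega), ha₁]
  intro k a' hk hR' hres
  -- An unchanged locus is written as reassigning its own value, to fit the common form of the
  -- result.
  have hstay : (u = l → g.length < M.length) → overlay N a' ((b.setReg 7 (addr g)).setReg 8
      (addr l)) = overlay N a' (((b.setReg 7 (addr g)).setReg 8 (addr l)).setReg 5 (addr u)) ∧
      IsLocusNode (c :: S) M u := by
    refine fun h => ⟨?_, hu.cons_of_not_split hg hl h⟩
    have : addr u = ((b.setReg 7 (addr g)).setReg 8 (addr l)).reg 5 := by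
      simp [State.reg_setReg, hb₅]
    rw [this, State.setReg_self]
  have hif : ∀ p : Prop, ∀ [Decidable p], (if p then 1 else 0) ≠ 0 ↔ p := by simp
  refine .ite (fun h => .ite (fun h' => .skip ?_) (fun h' => .assign ?_)) (fun h => .skip ?_)
  all_goals
    simp only [Expr.eval, overlay_reg_add, State.reg_setReg, BinOp.eval_eq hw, hb₅] at h
    simp only [Expr.cost, Expr.eval]
  · simp only [Expr.eval, overlay_reg_add, State.reg_setReg, BinOp.eval_lt hw, hb₄] at h'
    rw [overlay_reg_of_lt _ _ (by omega), hres] at h'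
    have hlt : g.length < M.length := by simpa using h'
    obtain ⟨h₁, h₂⟩ := hstay fun _ => hlt
    exact ⟨by omega, a', u, hR', h₂, h₁⟩
  · simp only [Expr.eval, overlay_reg_add, State.reg_setReg, BinOp.eval_lt hw, hb₄] at h'
    rw [overlay_reg_of_lt _ _ (by omega), hres] at h'
    have hle : M.length ≤ g.length := by simpa using h'
    -- If `g` was already a node, then `g = l = u`, and the assignment changes nothing.
    have hul : u = l := hinj _ _ (hu.1.cons c) (hl.1.cons c) (by simpa using h)
    exact ⟨by omega, a', g, hR', hu.cons_of_split hg (hul ▸ hl) hle, by simp [State.reg_setReg]⟩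
  · have hul : u ≠ l := by
      rintro rfl
      simp at h
    obtain ⟨h₁, h₂⟩ := hstay fun h => absurd h hul
    exact ⟨by omega, a', u, hR', h₂, h₁⟩

/-- A label is a prefix of the reversal of the first `e` letters of the text, `e` being the stored
end, so its letter `i` is text letter `e - 1 - i`. -/
theorem Index.getElem_node {X : List ℕ} (h : Index X addr b) {u : List ℕ}
    (hu : IsNode X.reverse u) {i : ℕ} (hi : i < u.length) :
    b.mem 1 (b.mem 2 (addr u) - 1 - i) = u[i] := by
  have h₁ := h.le_occ u hu
  have h₂ := h.occ_le u hu
  rw [h.text _ (by omega), (h.prefix_occ u hu).getElem hi]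
  simp only [List.getElem_reverse, List.getElem_take, List.length_take]
  congr 1
  omega

theorem run_matchLetter (hD : D.Maintains w n σ τ s Rep) (hNc : D.child.bound ≤ N)
    (hNd : D.depth.bound ≤ N) (hN₃ : 3 ≤ N) (hw : 1 < 2 ^ w) {X : List ℕ}
    (hR : Rep X.reverse addr a) (hX : Index X addr b) (hXw : X.length < 2 ^ w) (hc : c < σ)
    (hm : s * (X.length + 1) ≤ m) (hXm : X.length ≤ m) {M u : List ℕ}
    (hu : IsLocusNode X.reverse M u) (hb₁ : b.reg 1 = c) (hb₄ : b.reg 4 = M.length)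
    (hb₅ : b.reg 5 = addr u) :
    Run w m (matchLetter D N) (overlay N a b) fun k st => k ≤ 2 * τ + 40 ∧
      ∃ a' y x, Rep X.reverse addr a' ∧ st = overlay N a' ((b.setReg 8 y).setReg 5 x) ∧
        ((y = 1 ∧ ∃ v, IsLocusNode X.reverse (M ++ [c]) v ∧ x = addr v) ∨
          (y = 0 ∧ ¬ (M ++ [c]) <:+: X.reverse)) := by
  have hm' : s * (X.reverse.length + 1) ≤ m := by simpa using hm
  have hle := hX.le_occ u hu.1
  have hocc := hX.occ_le u hu.1
  refine .seq (run_callDepth hD hNd hN₃ hR hu.1 hm' ?_ ?_)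
  · simp [Expr.eval, hb₅]
  intro k a' hk hR' hres
  refine .ite (fun h => ?_) (fun h => ?_)
  all_goals
    simp only [Expr.eval, overlay_reg_add, BinOp.eval_lt hw, hb₄] at h
    rw [overlay_reg_of_lt _ _ (by omega), hres] at h
  · have hlt : M.length < u.length := by simpa using h
    refine .seq (.load ?_ (.seq ?_))
    · simp only [Expr.eval, overlay_reg_add, hb₅]
      have := (hD.address _ _ _ hR).2.1 u hu.1
      omega
    simp only [Expr.eval, overlay_reg_add, hb₅, overlay_mem_add, overlay_setReg_add]
    have hidx : (Expr.op .sub (.op .sub (.reg (N + 8)) (.const 1)) (.reg (N + 4))).eval w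
        (overlay N a' (b.setReg 8 (b.mem 2 (addr u)))) = b.mem 2 (addr u) - 1 - M.length := by
      have h₁ : BinOp.sub.eval w (b.mem 2 (addr u)) 1 = b.mem 2 (addr u) - 1 :=
        BinOp.eval_sub_of_le (by omega) (by omega)
      have h₂ : BinOp.sub.eval w (b.mem 2 (addr u) - 1) M.length =
          b.mem 2 (addr u) - 1 - M.length := BinOp.eval_sub_of_le (by omega) (by omega)
      simp [Expr.eval, State.reg_setReg, hb₄, Nat.mod_eq_of_lt hw, h₁, h₂]
    refine .load ?_ (.assign ?_)
    · rw [hidx]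
      omega
    · rw [hidx]
      simp only [overlay_mem_add, overlay_setReg_add, State.mem_setReg,
        hX.getElem_node hu.1 hlt, Expr.eval, overlay_reg_add, State.reg_setReg,
        BinOp.eval_eq hw, Expr.cost, State.setReg_setReg]
      refine ⟨by omega, a', if u[M.length] = c then 1 else 0, addr u, hR', ?_, ?_⟩
      · have : addr u = (b.setReg 8 (if u[M.length] = c then 1 else 0)).reg 5 := by
          simp [State.reg_setReg, hb₅]
        rw [this, State.setReg_self]
        simp [hb₁]
      · have hiff := hu.concat_infix_iff hlt c
        by_cases hcu : u[M.length] = c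
        · exact Or.inl ⟨if_pos hcu, u, hu.concat hlt hcu, rfl⟩
        · exact Or.inr ⟨if_neg hcu, fun h => hcu (hiff.1 h)⟩
  · have hMu : M = u := hu.2.1.eq_of_length_le (by simpa using h)
    subst hMu
    refine .seq (run_callChild hD hNc hN₃ hR' (fun _ => rfl) hu.1 hc hm' ?_ ?_ ?_)
    · simp [Expr.eval, hb₅]
    · simp [Expr.eval, hb₁]
    intro k' a'' hk' hR'' hres'
    refine .seq (.assign (.assign ?_))
    simp only [Expr.eval, overlay_setReg_add, Expr.cost]
    rw [overlay_reg_of_lt _ _ (by omega), overlay_reg_of_lt _ _ (by omega)]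
    -- After a failed query the locus value is arbitrary; the next stage resets it when it opens a
    -- new factor.
    refine ⟨by omega, a'', a''.reg 0, a''.reg 1, hR'', rfl, ?_⟩
    rcases hres' with ⟨v, hv, h₀, h₁⟩ | ⟨hv, h₀⟩
    · exact Or.inl ⟨h₀, v, hv, h₁⟩
    · exact Or.inr ⟨h₀, hv⟩

end Spec

/-! ## The invariant -/

/-- The contents of the private registers and arrays after the text `X` has been read, parsed as
`Fs` and `M`, where `u` is the node closest to `M`. -/
structure Own (X : List ℕ) (addr : List ℕ → ℕ) (Fs : List (List ℕ)) (M u : List ℕ) (b : State) :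
    Prop where
  index : Index X addr b
  length : b.reg 2 = X.length
  count : b.reg 3 = (allFactors Fs M).length
  matched : b.reg 4 = M.length
  locus : b.reg 5 = addr u
  starts : ∀ x < (allFactors Fs M).length, b.mem 3 x = ((allFactors Fs M).take x).flatten.length

/-- The states between two letters. -/
def Inv (N : ℕ) (Rep : List ℕ → (List ℕ → ℕ) → State → Prop) (X : List ℕ) (st : State) : Prop :=
  ∃ a b addr Fs M u, st = overlay N a b ∧ Rep X.reverse addr a ∧ Parse X Fs M ∧
    IsLocusNode X.reverse M u ∧ Own X addr Fs M u b

theorem Inv.holdsFactorization {N : ℕ} {Rep : List ℕ → (List ℕ → ℕ) → State → Prop} {X : List ℕ}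
    {st : State} (h : Inv N Rep X st) : HoldsFactorization (N + 3) (N + 3) X st := by
  obtain ⟨a, b, addr, Fs, M, u, rfl, -, hP, -, hO⟩ := h
  exact ⟨_, hP.isOverlapRevLZ, by simpa using hO.count, by simpa using hO.starts⟩

theorem inv_zero {D : SuffixTreeProgram} {w n σ τ s N : ℕ}
    {Rep : List ℕ → (List ℕ → ℕ) → State → Prop} (hD : D.Maintains w n σ τ s Rep) :
    Inv N Rep [] .zero := by
  obtain ⟨addr, hR⟩ := hD.start
  have h₀ := (hD.address _ _ _ hR).1
  refine ⟨.zero, .zero, addr, [], [], [], overlay_zero.symm, hR, parse_nil, isLocusNode_nil _, ?_⟩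
  refine ⟨⟨by simp, fun v hv => ?_, fun v hv => le_rfl, fun v hv => ?_⟩, rfl, rfl, rfl, h₀.symm,
    by simp [allFactors]⟩
  all_goals
    obtain rfl : v = [] := by simpa using hv.infix
    simp

theorem Index.congr {X : List ℕ} {addr : List ℕ → ℕ} {b b' : State} (h : Index X addr b)
    (h₁ : b'.mem 1 = b.mem 1) (h₂ : b'.mem 2 = b.mem 2) : Index X addr b' :=
  ⟨by simpa [h₁] using h.text, by simpa [h₂] using h.le_occ, by simpa [h₂] using h.occ_le,
    by simpa [h₂] using h.prefix_occ⟩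

theorem allFactors_concat {Fs : List (List ℕ)} {M : List ℕ} (c : ℕ) :
    allFactors Fs (M ++ [c]) = Fs ++ [M ++ [c]] := by
  simp [allFactors]

/-! ### Preservation of the invariant by one letter -/

section Step

variable {D : SuffixTreeProgram} {w n σ τ s m N : ℕ} {Rep : List ℕ → (List ℕ → ℕ) → State → Prop}
  {addr : List ℕ → ℕ} {a b : State} {c : ℕ} {X M u : List ℕ} {Fs : List (List ℕ)}

theorem run_emitFactor (hD : D.Maintains w n σ τ s Rep) (hNc : D.child.bound ≤ N) (hN₃ : 3 ≤ N)
    (hR : Rep (X ++ [c]).reverse addr a) (hX : Index (X ++ [c]) addr b)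
    (hXw : X.length + 1 < 2 ^ w) (hc : c < σ) (hm : s * (X.length + 2) ≤ m) (hXm : X.length < m)
    (hP : Parse X Fs M) {y : ℕ}
    (hy : (y = 1 ∧ ∃ v, IsLocusNode (X ++ [c]).reverse (M ++ [c]) v ∧ b.reg 5 = addr v) ∨
      (y = 0 ∧ ¬ (M ++ [c]) <:+: (X ++ [c]).reverse))
    (hb₁ : b.reg 1 = c) (hb₂ : b.reg 2 = X.length + 1)
    (hb₃ : b.reg 3 = (allFactors Fs M).length) (hb₄ : b.reg 4 = M.length)
    (hb₆ : b.reg 6 = if c ∈ X then 1 else 0) (hb₈ : b.reg 8 = y)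
    (hstarts : ∀ x < (allFactors Fs M).length,
      b.mem 3 x = ((allFactors Fs M).take x).flatten.length) :
    Run w m (emitFactor D N) (overlay N a b) fun k st =>
      k ≤ τ + 40 ∧ Inv N Rep (X ++ [c]) st := by
  have hw : 1 < 2 ^ w := by omega
  have hlen := hP.isOverlapRevLZ.length_le
  have hMX : M.length ≤ X.length := by
    have := congrArg List.length hP.flatten
    simp only [List.length_append] at this
    omega
  have hy₁ : y = 0 ∨ y = 1 := by tauto
  -- The product is nonzero exactly when a factor is open and the match succeeded; as `y ≤ 1`, it
  -- does not overflow.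
  have hmul : BinOp.mul.eval w M.length y = M.length * y :=
    BinOp.eval_mul_of_lt (by rcases hy₁ with rfl | rfl <;> omega)
  have hstarts' : ∀ x < (allFactors Fs M).length + 1,
      (b.setMem 3 (allFactors Fs M).length X.length).mem 3 x =
        ((allFactors Fs M ++ [[c]]).take x).flatten.length := by
    intro x hx
    rw [State.mem_setMem]
    rcases Nat.lt_or_ge x (allFactors Fs M).length with hlt | hge
    · rw [if_neg (by omega), List.take_append_of_le_length hlt.le, hstarts x hlt]
    · obtain rfl : x = (allFactors Fs M).length := by omega
      simp [hP.flatten_allFactors]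
  refine .ite (fun h => .assign ?_) (fun h => .seq (.store ?_ (.seq (.assign (.ite ?_ ?_)))))
  all_goals simp only [Expr.eval, overlay_reg_add, hb₄, hb₈, hmul] at h
  · obtain ⟨hM, hy₀⟩ := Nat.mul_ne_zero_iff.1 h
    have hM : M ≠ [] := by
      rintro rfl
      simp at hM
    obtain ⟨-, v, hv, hbv⟩ : y = 1 ∧ _ := hy.resolve_right fun h => hy₀ h.1
    simp only [Expr.eval, overlay_reg_add, overlay_setReg_add, hb₄, Nat.mod_eq_of_lt hw, Expr.cost,
      BinOp.eval_add_of_lt (show M.length + 1 < 2 ^ w by omega)]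
    have hall : allFactors Fs M = Fs ++ [M] := if_neg hM
    refine ⟨by omega, a, _, addr, Fs, M ++ [c], v, rfl, hR,
      hP.extend hM (by simpa using hv.infix), hv, hX.congr rfl rfl, ?_, ?_, ?_, ?_, ?_⟩
    · simp [State.reg_setReg, hb₂]
    · simp [State.reg_setReg, hb₃, hall, allFactors_concat]
    · simp [State.reg_setReg]
    · simp [State.reg_setReg, hbv]
    · intro x hx
      simp only [allFactors_concat, List.length_append, List.length_singleton] at hx ⊢
      rw [hall] at hstarts
      simp only [State.mem_setReg, hstarts x (by simpa using hx)]
      rw [List.take_append_of_le_length (by omega), List.take_append_of_le_length (by omega)]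
  · simp only [Expr.eval, overlay_reg_add, hb₃]
    omega
  all_goals
    have hnew : M ≠ [] → ¬ (M ++ [c]) <:+: c :: X.reverse := by
      intro hM
      have hy₀ : y = 0 := by simpa [hM] using h
      rcases hy with ⟨hy, -⟩ | ⟨-, hy⟩
      · omega
      · simpa using hy
    have hsub : BinOp.sub.eval w (X.length + 1) 1 = X.length :=
      BinOp.eval_sub_of_le (by omega) (by omega)
    simp only [Expr.eval, overlay_reg_add, overlay_setReg_add, overlay_setMem_add, hb₂, hb₃,
      hb₆, Nat.mod_eq_of_lt hw, hsub, State.reg_setMem, State.reg_setReg, Expr.cost,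
      BinOp.eval_add_of_lt (show (allFactors Fs M).length + 1 < 2 ^ w by omega)]
    intro h₆
  · have hcX : c ∈ X := by simpa using h₆
    refine .seq (run_callChild hD hNc hN₃ hR (fun _ => rfl) (isNode_nil _) hc (by simpa using hm)
      ?_ ?_ ?_)
    · simp [Expr.eval, (hD.address _ _ _ hR).1]
    · simp [Expr.eval, State.reg_setReg, hb₁]
    intro k a' hk hR' hres
    -- The query cannot fail: `c` is now the first letter of the indexed string.
    obtain ⟨v, hv, -, hv₁⟩ := hres.resolve_right fun h =>
      h.1 (by simpa using (List.prefix_append [c] X.reverse).isInfix)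
    refine .seq (.assign (.assign ?_))
    simp only [Expr.eval, overlay_setReg_add, Expr.cost, Nat.mod_eq_of_lt hw]
    rw [overlay_reg_of_lt _ _ (by omega), hv₁]
    have hall : allFactors (allFactors Fs M) [c] = allFactors Fs M ++ [[c]] := if_neg (by simp)
    refine ⟨by omega, a', _, addr, allFactors Fs M, [c], v, rfl, hR', hP.new_of_mem hnew hcX, hv,
      hX.congr ?_ ?_, ?_, ?_, ?_, ?_, ?_⟩
    · funext i; simp [State.mem_setMem]
    · funext i; simp [State.mem_setMem]
    · simp [State.reg_setReg, hb₂]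
    · simp [State.reg_setReg, hall]
    · simp [State.reg_setReg]
    · simp [State.reg_setReg]
    · simpa [hall] using hstarts'
  · have hcX : c ∉ X := by simpa using h₆
    refine .seq (.assign (.assign ?_))
    simp only [Expr.eval, overlay_setReg_add, Expr.cost, Nat.zero_mod]
    have hall : allFactors (allFactors Fs M ++ [[c]]) [] = allFactors Fs M ++ [[c]] := if_pos rfl
    refine ⟨by omega, a, _, addr, allFactors Fs M ++ [[c]], [], [], rfl, hR,
      hP.new_of_not_mem hnew hcX, isLocusNode_nil _, hX.congr ?_ ?_, ?_, ?_, ?_, ?_, ?_⟩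
    · funext i; simp [State.mem_setMem]
    · funext i; simp [State.mem_setMem]
    · simp [State.reg_setReg, hb₂]
    · simp [State.reg_setReg, hall]
    · simp [State.reg_setReg]
    · simp [State.reg_setReg, (hD.address _ _ _ hR).1]
    · simpa [hall] using hstarts'

/-- The factor `6` counts one update, two depth queries and at most three child queries. -/
theorem run_processLetter (hD : D.Maintains w n σ τ s Rep) (hNu : D.update.bound ≤ N)
    (hNc : D.child.bound ≤ N) (hNd : D.depth.bound ≤ N) (hN₃ : 3 ≤ N) (hnw : n < 2 ^ w)
    {st : State} (h : Inv N Rep X st) (hc : c < σ) (hX : X.length < n)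
    (hm : s * (X.length + 2) ≤ m) (hXm : X.length < m) :
    Run w m (processLetter D N) (st.setReg 0 c) fun k st' =>
      k ≤ 6 * τ + 140 ∧ Inv N Rep (X ++ [c]) st' := by
  obtain ⟨a, b, addr, Fs, M, u, rfl, hR, hP, hu, hO⟩ := h
  have hw : 1 < 2 ^ w := by omega
  have hrev : (X ++ [c]).reverse = c :: X.reverse := by simp
  have hm₁ : s * (X.reverse.length + 1) ≤ m :=
    (Nat.mul_le_mul_left s (by simp)).trans hm
  rw [overlay_setReg_of_lt _ _ (by omega)]
  refine .seq ((run_readLetter hD hNc hN₃ hR hc hm₁).imp ?_)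
  rintro k₁ _ ⟨hk₁, a₁, hR₁, rfl⟩
  refine .seq ((run_extendTree hD hNu hN₃ hw hR₁ hc (by simpa using hX) (by simp; omega)
    (by simpa using hm) (by simpa using hXm) (by simp [State.reg_setReg])
    (by simp [State.reg_setReg, hO.length])).imp ?_)
  rintro k₂ _ ⟨hk₂, a₂, addr₂, g, l, hR₂, hold, hg, hl, ha₁, ha₂, rfl⟩
  refine .seq ((run_moveLocus hD hNd hN₃ hw hR₂ (by simpa using hm) hu hg hl ha₁ ha₂
    (by simp [State.reg_setReg, hO.matched])
    (by simp [State.reg_setReg, hO.locus, hold u hu.1])).imp ?_)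
  rintro k₃ _ ⟨hk₃, a₃, u₃, hR₃, hu₃, rfl⟩
  have hidx := (hO.index.congr (b' := (b.setReg 1 c).setReg 6 (if c ∈ X.reverse then 1 else 0))
    rfl rfl).extend hold (hD.address _ _ _ hR₂).2.2 hg
  rw [← hrev] at hR₃ hu₃
  refine .seq ((run_matchLetter (X := X ++ [c]) hD hNc hNd hN₃ hw hR₃ (hidx.congr ?_ ?_)
    (by simp; omega) hc (by simpa using hm) (by simp; omega) hu₃ ?_ ?_ ?_).imp ?_)
  · simp
  · simp
  · simp [State.reg_setReg]
  · simp [State.reg_setReg, hO.matched]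
  · simp [State.reg_setReg]
  rintro k₄ _ ⟨hk₄, a₄, y, x, hR₄, rfl, hy⟩
  refine (run_emitFactor hD hNc hN₃ hR₄ (hidx.congr ?_ ?_) (by omega) hc hm hXm hP (y := y)
    ?_ ?_ ?_ ?_ ?_ ?_ ?_ ?_).imp ?_
  · simp
  · simp
  · simpa [State.reg_setReg] using hy
  · simp [State.reg_setReg]
  · simp [State.reg_setReg]
  · simp [State.reg_setReg, hO.count]
  · simp [State.reg_setReg, hO.matched]
  · simp [State.reg_setReg]
  · simp [State.reg_setReg]
  · simpa [State.mem_setMem] using hO.starts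
  · rintro k₅ st' ⟨hk₅, hinv⟩
    exact ⟨by omega, hinv⟩

end Step

end RevLZ

/-! ### The main theorem: constants and iteration over the text -/

open RevLZ in
theorem mainTheorem8 (D : SuffixTreeProgram) (R : ℕ → ℕ → Prop) (t : ℕ → ℕ → ℕ)
    (hD : D.Solves R t) :
    ∃ (P : Cmd) (z a κ K : ℕ), ∀ n σ w : ℕ, R n σ → (n + σ + 2) ^ κ ≤ 2 ^ w →
      ∀ T : List ℕ, T.length = n → (∀ c ∈ T, c < σ) →
        ∃ st : ℕ → State, st 0 = State.zero ∧
          (∀ j ≤ n, HoldsFactorization z a (T.take j) (st j)) ∧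
          ∀ (j : ℕ) (hj : j < T.length),
            ∃ k ≤ K * t n σ, Exec w (K * (j + 1)) P ((st j).setReg 0 T[j]) k (st (j + 1)) := by
  obtain ⟨s, κ, hD⟩ := hD
  obtain ⟨N, hNu, hNc, hNd, hN₃⟩ : ∃ N, D.update.bound ≤ N ∧ D.child.bound ≤ N ∧
      D.depth.bound ≤ N ∧ 3 ≤ N :=
    ⟨D.update.bound + D.child.bound + D.depth.bound + 3, by omega, by omega, by omega, by omega⟩
  -- Exponent `κ + 1` gives `n < 2 ^ w` even for `κ = 0`. The constant covers `6 * τ + 140 ≤ 146 *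
  -- τ` steps for `τ ≥ 1`, and `s * (j + 2) ≤ 2 * s * (j + 1)` cells.
  refine ⟨processLetter D N, N + 3, N + 3, κ + 1, 2 * s + 146, ?_⟩
  rintro n σ w hnσ hw T rfl hT
  obtain ⟨Rep, hM⟩ := hD T.length σ w hnσ ((Nat.pow_le_pow_right (by omega) (by omega)).trans hw)
  have hnw : T.length < 2 ^ w := by
    have := (Nat.le_self_pow (Nat.succ_ne_zero κ) (T.length + σ + 2)).trans hw
    omega
  have step : ∀ (j : ℕ) (hj : j < T.length) (st : State), Inv N Rep (T.take j) st →
      Run w ((2 * s + 146) * (j + 1)) (processLetter D N) (st.setReg 0 T[j]) fun k st' =>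
        k ≤ (2 * s + 146) * t T.length σ ∧ Inv N Rep (T.take (j + 1)) st' := by
    intro j hj st hst
    have hc : T[j] < σ := hT _ (List.getElem_mem hj)
    have hlen : (T.take j).length = j := by simp; omega
    -- Every execution takes at least one step, so an update of the empty string already shows that
    -- the time bound is positive.
    have hpos : 1 ≤ t T.length σ := by
      obtain ⟨addr, hR⟩ := hM.start
      obtain ⟨k, hk, _, _, hex, -⟩ := hM.update [] addr _ _ hR hc (by simp; omega)
      exact hex.pos.trans_le hk
    refine (run_processLetter (X := T.take j) hM hNu hNc hNd hN₃ hnw hst hc (by omega) ?_ ?_).imp ?_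
    · rw [hlen]
      nlinarith
    · rw [hlen]
      nlinarith
    · rintro k st' ⟨hk, hinv⟩
      refine ⟨by nlinarith, ?_⟩
      rwa [List.take_add_one, List.getElem?_eq_getElem hj]
  -- Outside the invariant the successor state is a dummy, which makes `next` total and allows plain
  -- recursion.
  choose! next hnext using fun (j : ℕ) (st : State) =>
    show ∃ st', ∀ hj : j < T.length, Inv N Rep (T.take j) st →
        Inv N Rep (T.take (j + 1)) st' ∧ ∃ k ≤ (2 * s + 146) * t T.length σ,
          Exec w ((2 * s + 146) * (j + 1)) (processLetter D N) (st.setReg 0 T[j]) k st' by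
      by_cases h : j < T.length ∧ Inv N Rep (T.take j) st
      · obtain ⟨k, st', hex, hk, hinv⟩ := step j h.1 st h.2
        exact ⟨st', fun _ _ => ⟨hinv, k, hk, hex⟩⟩
      · exact ⟨st, fun hj hst => absurd ⟨hj, hst⟩ h⟩
  let st : ℕ → State := fun j => Nat.rec State.zero next j
  have hinv : ∀ j ≤ T.length, Inv N Rep (T.take j) (st j) := by
    intro j
    induction j with
    | zero => exact fun _ => inv_zero hM
    | succ j ih => exact fun hj => (hnext j (st j) hj (ih (by omega))).1
  exact ⟨st, rfl, fun j hj => (hinv j hj).holdsFactorization,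
    fun j hj => (hnext j (st j) hj (hinv j hj.le)).2⟩
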